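/- Let $p$ be an odd prime and let $\gamma$ be a self-conjugate $p$-core, i.e. a partition equal to its conjugate that has no rim hook of length $p$. Let $\mathfrak{B}_\gamma$ be the set of partitions of $p$-weight $2$ with $p$-core $\gamma$, i.e. those from which $\gamma$ is obtained by successively removing two rim hooks of length $p$. For $\lambda\in\mathfrak{B}_\gamma$ let $\partial\lambda$ be the absolute value of the difference of the leg lengths of these two rim hooks (it does not depend on how they are removed), and let $\partial_l=\{\lambda\in\mathfrak{B}_\gamma \mid \partial\lambda=l\}$. Place beads at the integers $\gamma_i-i$, $i\ge 1$, on the abacus with $p$ runners (the residue classes modulo $p$; positions increase downwards), and let $\rho_0<\rho_1<\dots<\rho_{p-1}$ be the positions of the lowest beads of the $p$ runners; call the runner containing $\rho_i$ runner $i$. The pyramid of $\gamma$ is the array with entries ${}_i\gamma_j=1$ if $\rho_j-\rho_i<p$ and ${}_i\gamma_j=0$ otherwise, for $0\le i\le j\le p-1$; put also ${}_i\gamma_j=1$ if $i>j$, and ${}_i\gamma_j=0$ if $i\le j$ and $j\ge p$. Denote by $\langle i,j\rangle$ (for $i<j$), $\langle i\rangle$ and $\langle i^2\rangle$ the partitions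 in $\mathfrak{B}_\gamma$ whose abacus is obtained from that of $\gamma$ by moving, respectively: the lowest bead on each of the runners $i$ and $j$ down one position; the lowest bead on runner $i$ down two positions; the lowest bead on runner $i$ and then the next bead above it down one position each. For $0\le i<j\le p-1$ let \[ \lceil i,j\rfloor=\begin{cases} \langle i+1,j\rangle & \text{if } {}_{i+1}\gamma_j=0,\\ \langle j^2\rangle & \text{if } {}_{i+1}\gamma_j=1 \text{ and } {}_i\gamma_j=0,\\ \langle i\rangle & \text{if } {}_i\gamma_j=1 \text{ and } {}_i\gamma_{j+1}=0,\\ \langle i,j+1\rangle & \text{if } {}_i\gamma_{j+1}=1. \end{cases} \] For $1\le k\le\frac{p-1}{2}$ set \[ \nu_k=\Bigl\langle \tfrac{p-1}{2}-k,\tfrac{p-1}{2}+k\Bigr\rangle,\qquad \mu_k=\Bigl\lceil \tfrac{p-1}{2}-k,\tfrac{p-1}{2}+k\Bigr\rfloor,\qquad g_k={}_{\frac{p-1}{2}-k}\gamma_{\frac{p-1}{2}+k}, \] and let $\delta=\delta(\gamma)$ be the largest $k\in\{1,\dots,\frac{p-1}{2}\}$ with $g_k=1$, or $\delta=0$ if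 there is no such $k$. Then for every $k=1,\dots,\frac{p-1}{2}$: - if $k\le\delta$, then $\mu_k\in\partial_{2k}$ and $\nu_k\in\partial_{2k-1}$; - if $k>\delta$, then $\mu_k\in\partial_{2k-1}$ and $\nu_k\in\partial_{2k}$. -/

import Mathlib

/-! Partitions are Young diagrams, with rows and columns numbered from `0`. -/

namespace WeightTwo

noncomputable section

/-! ### Hooks, rim hooks, cores and blocks -/

/-- The number of nodes of `lam` strictly to the right of the node `c` in its row. -/
def armLength (lam : YoungDiagram) (c : ℕ × ℕ) : ℕ := lam.rowLen c.1 - c.2 - 1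

/-- The number of nodes of `lam` strictly below the node `c` in its column. -/
def legLength (lam : YoungDiagram) (c : ℕ × ℕ) : ℕ := lam.colLen c.2 - c.1 - 1

/-- The length of the hook at the node `c`. -/
def hookLength (lam : YoungDiagram) (c : ℕ × ℕ) : ℕ := armLength lam c + legLength lam c + 1

/-- The rim hook associated with the node `c`: the part of the rim of `lam` from the last node of
the row of `c` to the last node of the column of `c`. -/
def rimHook (lam : YoungDiagram) (c : ℕ × ℕ) : Finset (ℕ × ℕ) :=
  lam.cells.filter fun d => c.1 ≤ d.1 ∧ c.2 ≤ d.2 ∧ (d.1 + 1, d.2 + 1) ∉ lam.cells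

/-- `mu` is obtained from `lam` by removing a rim hook of length `p` and leg length `leg`. -/
def RemovesRimHook (p : ℕ) (lam mu : YoungDiagram) (leg : ℕ) : Prop :=
  ∃ c ∈ lam.cells, hookLength lam c = p ∧ legLength lam c = leg ∧
    mu.cells = lam.cells \ rimHook lam c

/-- A `p`-core is a partition without rim hooks of length `p`. -/
def IsCore (p : ℕ) (lam : YoungDiagram) : Prop := ∀ c ∈ lam.cells, hookLength lam c ≠ p

/-- The partitions from which the `p`-core `gam` is reached by successively removing `w` rim
hooks of length `p`, that is, the partitions with `p`-core `gam` and `p`-weight `w`. -/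
def block (p : ℕ) (gam : YoungDiagram) : ℕ → Set YoungDiagram
  | 0 => {gam}
  | w + 1 => {lam | ∃ mu leg, RemovesRimHook p lam mu leg ∧ mu ∈ block p gam w}

/-- The set `∂_l`: the partitions `lam` of weight `2` with `p`-core `gam` for which the absolute
value of the difference of the leg lengths of the two rim hooks of length `p` that are successively
removed to reach `gam` is `l`, for every way of removing them (there is at least one way, because
`lam` is in the block). -/
def drond (p : ℕ) (gam : YoungDiagram) (l : ℕ) : Set YoungDiagram :=
  {lam | lam ∈ block p gam 2 ∧ ∀ (mu : YoungDiagram) (l₁ l₂ : ℕ),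
    RemovesRimHook p lam mu l₁ → RemovesRimHook p mu gam l₂ → |(l₁ : ℤ) - (l₂ : ℤ)| = (l : ℤ)}

/-! ### The abacus -/

/-- The beta-numbers `lam_i - i`, `i ≥ 1`, which are the positions of the beads on the abacus. -/
def beads (lam : YoungDiagram) : Set ℤ :=
  Set.range fun i : ℕ => (lam.rowLen i : ℤ) - ((i : ℤ) + 1)

/-- A partition is determined by its abacus. -/
theorem beads_injective : Function.Injective beads := by
  have anti : ∀ lam : YoungDiagram,
      StrictMono fun i : ℕ => -((lam.rowLen i : ℤ) - ((i : ℤ) + 1)) := by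
    intro lam i j hij
    have h := lam.rowLen_anti i j hij.le
    dsimp only
    omega
  intro lam mu h
  have h' : Set.range (fun i : ℕ => -((lam.rowLen i : ℤ) - ((i : ℤ) + 1))) =
      Set.range (fun i : ℕ => -((mu.rowLen i : ℤ) - ((i : ℤ) + 1))) := by
    have := congrArg (fun s : Set ℤ => (fun x => -x) '' s) h
    simpa only [beads, ← Set.range_comp, Function.comp_def] using this
  have key := (StrictMono.range_inj (anti lam) (anti mu)).1 h'
  have hrow : ∀ i, lam.rowLen i = mu.rowLen i := by
    intro i
    have := congrFun key i
    omega
  ext ⟨i, j⟩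
  simp only [YoungDiagram.mem_cells, YoungDiagram.mem_iff_lt_rowLen, hrow]

/-- The partition whose abacus has its beads exactly at the positions in `B`. -/
def ofBeads (B : Set ℤ) : YoungDiagram := Function.invFun beads B

/-- The position of the lowest bead on the runner of the positions congruent to `r` modulo `p`
(positions increase downwards). -/
def lowestBead (p : ℕ) (gam : YoungDiagram) (r : ℕ) : ℤ :=
  sSup {x : ℤ | x ∈ beads gam ∧ x ≡ (r : ℤ) [ZMOD (p : ℤ)]}

/-- The positions `ρ_0 < ρ_1 < ⋯ < ρ_{p-1}` of the lowest beads of the `p` runners, in increasing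
order; `rho p gam i` is used for `i < p` only. -/
def rho (p : ℕ) (gam : YoungDiagram) (i : ℕ) : ℤ :=
  (((Finset.range p).image (lowestBead p gam)).sort (· ≤ ·)).getD i 0

/-- The entries of the pyramid of `gam`, with the values `1` below it and `0` to the right of it. -/
def pyramid (p : ℕ) (gam : YoungDiagram) (i j : ℕ) : ℕ :=
  if j < i then 1
  else if p ≤ j then 0
  else if rho p gam j - rho p gam i < (p : ℤ) then 1
  else 0

/-! ### Labels of the partitions in the block of weight two -/

/-- `⟨i, j⟩`: the lowest beads on the runners `i` and `j` are moved down one position each. -/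
def lrPair (p : ℕ) (gam : YoungDiagram) (i j : ℕ) : YoungDiagram :=
  ofBeads ((beads gam \ {rho p gam i, rho p gam j}) ∪ {rho p gam i + p, rho p gam j + p})

/-- `⟨i⟩`: the lowest bead on the runner `i` is moved down two positions. -/
def lrOne (p : ℕ) (gam : YoungDiagram) (i : ℕ) : YoungDiagram :=
  ofBeads ((beads gam \ {rho p gam i}) ∪ {rho p gam i + 2 * p})

/-- `⟨i²⟩`: the lowest bead on the runner `i` is moved down one position, and then the next bead
above it is moved down one position. -/
def lrSq (p : ℕ) (gam : YoungDiagram) (i : ℕ) : YoungDiagram :=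
  ofBeads ((beads gam \ {rho p gam i, rho p gam i - p}) ∪ {rho p gam i + p, rho p gam i})

/-- `⌈i, j⌋`, for `0 ≤ i ≤ j < p` and `i < p - 1`. A `1` in the pyramid has only `1`s below it, so
the six cases of the definition are exclusive and exhaustive. -/
def fn (p : ℕ) (gam : YoungDiagram) (i j : ℕ) : YoungDiagram :=
  if i = j then
    if pyramid p gam (i + 1) (i + 2) = 0 then lrOne p gam (i + 1)
    else lrPair p gam (i + 1) (i + 2)
  else if pyramid p gam (i + 1) j = 0 then lrPair p gam (i + 1) j
  else if pyramid p gam i j = 0 then lrSq p gam j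
  else if pyramid p gam i (j + 1) = 0 then lrOne p gam i
  else lrPair p gam i (j + 1)

/-- `ν_k = ⟨(p-1)/2 - k, (p-1)/2 + k⟩`. -/
def nu (p : ℕ) (gam : YoungDiagram) (k : ℕ) : YoungDiagram :=
  lrPair p gam ((p - 1) / 2 - k) ((p - 1) / 2 + k)

/-- `μ_k = ⌈(p-1)/2 - k, (p-1)/2 + k⌋`. -/
def mu (p : ℕ) (gam : YoungDiagram) (k : ℕ) : YoungDiagram :=
  fn p gam ((p - 1) / 2 - k) ((p - 1) / 2 + k)

/-- The entry `g_k` of the middle column of the pyramid, in row `2 k`. -/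
def middleEntry (p : ℕ) (gam : YoungDiagram) (k : ℕ) : ℕ :=
  pyramid p gam ((p - 1) / 2 - k) ((p - 1) / 2 + k)

/-- `δ`: the largest `k` with `1 ≤ k ≤ (p-1)/2` and `g_k = 1`, and `0` if there is none. -/
def delta (p : ℕ) (gam : YoungDiagram) : ℕ :=
  ((Finset.Icc 1 ((p - 1) / 2)).filter fun k => middleEntry p gam k = 1).sup id

end

end WeightTwo

namespace WeightTwo

/-! ### Beads and rim hooks -/

/-! On the abacus, removing a rim hook of length `p` moves a bead up one position on its runner, and
its leg length is the number of beads passed (`removesRimHook_iff`). On the runners of a core there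
are no gaps above the lowest beads, so the beads strictly between two consecutive positions `y` and
`y + p` of runner `i` correspond to the runners `j ≠ i` with `ρ_j > y` (`ncard_beads_between`).
Moving a single bead from `ρ_j + p` back to `ρ_j` therefore has leg length `p - 1 - j`.

The first leg length then follows for each label. For `⟨i, j⟩` the count is corrected by one exactly
when `ρ_j < ρ_i + p`, and the difference of the legs is `j - i` minus the pyramid entry, whichever
bead moves first. For `⟨i⟩` it is `m - i`, with `m` the last runner such that `ρ_m < ρ_i + p`. For
`⟨j²⟩` it is `j - i - 1`, with `i` the last runner such that `ρ_i ≤ ρ_j - p`.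

Consequently all four cases of `⌈i, j⌋` give `j - i - 1` plus the entry at `(i, j)`
(`fn_mem_drond`). On the middle column `j - i = 2k`, so `ν_k` has value `2k - g_k` and `μ_k` has
value `2k - 1 + g_k`. Finally `g_k = 1` exactly for `k ≤ δ`, because the intervals from
`ρ_{(p-1)/2-k}` to `ρ_{(p-1)/2+k}` are nested. -/

theorem bead_strictAnti (lam : YoungDiagram) :
    StrictAnti fun i : ℕ => (lam.rowLen i : ℤ) - ((i : ℤ) + 1) := by
  intro i j hij
  have h := lam.rowLen_anti i j hij.le
  dsimp only
  omega

/-- A position without a bead separates the rows with larger beads from those with smaller ones. -/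
theorem exists_row_of_notMem_beads {lam : YoungDiagram} {y : ℤ} (hy : y ∉ beads lam) :
    ∃ n : ℕ, (∀ i < n, y < (lam.rowLen i : ℤ) - ((i : ℤ) + 1)) ∧
      ∀ i, n ≤ i → (lam.rowLen i : ℤ) - ((i : ℤ) + 1) < y := by
  classical
  have hex : ∃ i : ℕ, (lam.rowLen i : ℤ) - ((i : ℤ) + 1) < y := by
    refine ⟨lam.rowLen 0 + y.natAbs, ?_⟩
    have := lam.rowLen_anti 0 (lam.rowLen 0 + y.natAbs) (Nat.zero_le _)
    omega
  refine ⟨Nat.find hex, fun i hi => ?_, fun i hi => ?_⟩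
  · have h1 := Nat.find_min hex hi
    have h2 : (lam.rowLen i : ℤ) - ((i : ℤ) + 1) ≠ y := fun h => hy ⟨i, h⟩
    omega
  · exact ((bead_strictAnti lam).antitone hi).trans_lt (Nat.find_spec hex)

theorem rowLen_eq_of_forall {lam : YoungDiagram} {i n : ℕ} (h : ∀ j, (i, j) ∈ lam ↔ j < n) :
    lam.rowLen i = n :=
  eq_of_forall_lt_iff fun j => by rw [← YoungDiagram.mem_iff_lt_rowLen, h]

theorem colLen_eq_of_forall {lam : YoungDiagram} {j n : ℕ} (h : ∀ i, (i, j) ∈ lam ↔ i < n) :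
    lam.colLen j = n :=
  eq_of_forall_lt_iff fun i => by rw [← YoungDiagram.mem_iff_lt_colLen, h]

/-- The positions without a bead come from the columns. -/
theorem notMem_beads_iff {lam : YoungDiagram} {y : ℤ} :
    y ∉ beads lam ↔ ∃ b : ℕ, y = (b : ℤ) - lam.colLen b := by
  constructor
  · intro hy
    obtain ⟨n, h1, h2⟩ := exists_row_of_notMem_beads hy
    have hn := h2 n le_rfl
    -- The inequality for row `n` says that its length is at most `y + n`, so this number is a
    -- column index; the rows before `n` are longer than it, so that column has exactly `n` nodes.
    obtain ⟨b, hb⟩ : ∃ b : ℕ, (b : ℤ) = y + n := ⟨(y + n).toNat, by omega⟩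
    refine ⟨b, ?_⟩
    have : lam.colLen b = n := by
      refine colLen_eq_of_forall fun i => ?_
      rw [YoungDiagram.mem_iff_lt_rowLen]
      refine ⟨fun h => ?_, fun h => ?_⟩
      · by_contra hi
        have := lam.rowLen_anti n i (not_lt.1 hi)
        omega
      · have h3 := lam.rowLen_anti i (n - 1) (by omega)
        have h4 := h1 (n - 1) (by omega)
        omega
    omega
  · rintro ⟨b, rfl⟩ ⟨i, hi⟩
    have h1 : (i, b) ∈ lam ↔ b < lam.rowLen i := YoungDiagram.mem_iff_lt_rowLen
    have h2 : (i, b) ∈ lam ↔ i < lam.colLen b := YoungDiagram.mem_iff_lt_colLen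
    have h3 := h1.symm.trans h2
    dsimp only at hi
    omega

/-- The hook length is the distance from the bead of the row to the gap of the column. -/
theorem hookLength_eq {lam : YoungDiagram} {a b : ℕ} (h : (a, b) ∈ lam) :
    (hookLength lam (a, b) : ℤ) =
      ((lam.rowLen a : ℤ) - ((a : ℤ) + 1)) - ((b : ℤ) - lam.colLen b) := by
  have h1 := YoungDiagram.mem_iff_lt_rowLen.1 h
  have h2 := YoungDiagram.mem_iff_lt_colLen.1 h
  simp only [hookLength, armLength, legLength]
  omega

/-- The leg length is the number of beads between the bead of the row and the gap of the column. -/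
theorem legLength_eq (lam : YoungDiagram) (a b : ℕ) :
    legLength lam (a, b) = {z | z ∈ beads lam ∧ (b : ℤ) - lam.colLen b < z ∧
      z < (lam.rowLen a : ℤ) - ((a : ℤ) + 1)}.ncard := by
  have hset : {z | z ∈ beads lam ∧ (b : ℤ) - lam.colLen b < z ∧
      z < (lam.rowLen a : ℤ) - ((a : ℤ) + 1)} =
      (fun i : ℕ => (lam.rowLen i : ℤ) - ((i : ℤ) + 1)) ''
        (Finset.Ioo a (lam.colLen b) : Set ℕ) := by
    ext z
    simp only [Set.mem_ofPred_eq, Set.mem_image, Finset.coe_Ioo, Set.mem_Ioo]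
    constructor
    · rintro ⟨⟨i, rfl⟩, h1, h2⟩
      refine ⟨i, ⟨(bead_strictAnti lam).lt_iff_gt.1 h2, ?_⟩, rfl⟩
      rw [← YoungDiagram.mem_iff_lt_colLen, YoungDiagram.mem_iff_lt_rowLen]
      by_contra hb
      have h3 : ¬ i < lam.colLen b := by
        rwa [← YoungDiagram.mem_iff_lt_colLen, YoungDiagram.mem_iff_lt_rowLen]
      dsimp only at h1
      omega
    · rintro ⟨i, ⟨h1, h2⟩, rfl⟩
      refine ⟨⟨i, rfl⟩, ?_, bead_strictAnti lam h1⟩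
      have h3 := h2
      rw [← YoungDiagram.mem_iff_lt_colLen, YoungDiagram.mem_iff_lt_rowLen] at h3
      omega
  rw [hset, Set.ncard_image_of_injective _ (bead_strictAnti lam).injective, Set.ncard_coe_finset,
    Nat.card_Ioo]
  simp only [legLength]

/-- Removing the rim hook of a node moves the bead of its row to the gap of its column. -/
theorem beads_of_cells_eq_sdiff_rimHook {lam mu : YoungDiagram} {a b : ℕ} (h : (a, b) ∈ lam)
    (hmu : mu.cells = lam.cells \ rimHook lam (a, b)) :
    beads mu = insert ((b : ℤ) - lam.colLen b)
      (beads lam \ {(lam.rowLen a : ℤ) - ((a : ℤ) + 1)}) := by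
  have hmem : ∀ i j, (i, j) ∈ mu ↔
      (i, j) ∈ lam ∧ ¬ (a ≤ i ∧ b ≤ j ∧ ¬ (i + 1, j + 1) ∈ lam) := by
    intro i j
    rw [← YoungDiagram.mem_cells, hmu]
    simp only [Finset.mem_sdiff, rimHook, Finset.mem_filter, YoungDiagram.mem_cells]
    tauto
  simp only [YoungDiagram.mem_iff_lt_rowLen (μ := lam)] at hmem
  have hcol : ∀ i, b < lam.rowLen i ↔ i < lam.colLen b := fun i => by
    rw [← YoungDiagram.mem_iff_lt_rowLen, YoungDiagram.mem_iff_lt_colLen]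
  have hac : a < lam.colLen b := YoungDiagram.mem_iff_lt_colLen.1 h
  -- Each row from `a` to the one before the last row of column `b` becomes the next row shortened
  -- by one node, which keeps the bead of that next row. Only the bead of row `a` disappears, and
  -- the last row of the column supplies the new bead.
  have r1 : ∀ i < a, mu.rowLen i = lam.rowLen i := fun i hi =>
    rowLen_eq_of_forall fun j => by rw [hmem]; omega
  have r2 : ∀ i, a ≤ i → i + 1 < lam.colLen b → mu.rowLen i = lam.rowLen (i + 1) - 1 :=
    fun i hi hi' => rowLen_eq_of_forall fun j => by
      rw [hmem]
      have h1 := (hcol (i + 1)).2 hi'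
      have h2 := lam.rowLen_anti i (i + 1) (Nat.le_succ i)
      omega
  have r3 : ∀ i, i + 1 = lam.colLen b → mu.rowLen i = b :=
    fun i hi => rowLen_eq_of_forall fun j => by
      rw [hmem]
      have h1 := (hcol i).2 (by omega)
      have h2 := hcol (i + 1)
      omega
  have r4 : ∀ i, lam.colLen b ≤ i → mu.rowLen i = lam.rowLen i :=
    fun i hi => rowLen_eq_of_forall fun j => by
      rw [hmem]
      have h1 := hcol i
      omega
  ext z
  simp only [Set.mem_insert_iff, Set.mem_sdiff, Set.mem_singleton_iff]
  constructor
  · rintro ⟨i, rfl⟩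
    dsimp only
    rcases lt_or_ge i a with hi | hi
    · right
      rw [r1 i hi]
      exact ⟨⟨i, rfl⟩, (bead_strictAnti lam hi).ne'⟩
    rcases lt_trichotomy (i + 1) (lam.colLen b) with hi' | hi' | hi'
    · right
      have h1 := (hcol (i + 1)).2 hi'
      have h2 : ((mu.rowLen i : ℤ) - ((i : ℤ) + 1)) =
          (lam.rowLen (i + 1) : ℤ) - (((i + 1 : ℕ) : ℤ) + 1) := by
        rw [r2 i hi hi']; omega
      rw [h2]
      exact ⟨⟨i + 1, rfl⟩, (bead_strictAnti lam (Nat.lt_succ_of_le hi)).ne⟩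
    · left
      rw [r3 i hi']; omega
    · right
      rw [r4 i (by omega)]
      exact ⟨⟨i, rfl⟩, (bead_strictAnti lam (show a < i by omega)).ne⟩
  · rintro (rfl | ⟨⟨i, rfl⟩, hne⟩)
    · refine ⟨lam.colLen b - 1, ?_⟩
      dsimp only
      rw [r3 _ (by omega)]; omega
    · have hia : i ≠ a := by rintro rfl; exact hne rfl
      rcases lt_or_ge i a with hi | hi
      · exact ⟨i, by dsimp only; rw [r1 i hi]⟩
      rcases lt_or_ge i (lam.colLen b) with hi' | hi'
      · refine ⟨i - 1, ?_⟩
        have h1 := (hcol i).2 hi'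
        have h2 := r2 (i - 1) (by omega) (by omega)
        rw [Nat.sub_add_cancel (by omega)] at h2
        dsimp only
        omega
      · exact ⟨i, by dsimp only; rw [r4 i hi']⟩

/-- The diagram left after removing the rim hook of a node. -/
theorem exists_cells_eq_sdiff_rimHook (lam : YoungDiagram) (c : ℕ × ℕ) :
    ∃ mu : YoungDiagram, mu.cells = lam.cells \ rimHook lam c := by
  refine ⟨⟨lam.cells \ rimHook lam c, ?_⟩, rfl⟩
  intro d e hed hd
  simp only [Finset.coe_sdiff, Set.mem_sdiff, Finset.mem_coe, rimHook, Finset.mem_filter,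
    not_and, not_not] at hd ⊢
  have he : e ∈ lam.cells := lam.isLowerSet hed hd.1
  refine ⟨he, fun _ h1 h2 => ?_⟩
  have := hd.2 hd.1 (h1.trans hed.1) (h2.trans hed.2)
  exact lam.isLowerSet (Prod.mk_le_mk.2 ⟨Nat.succ_le_succ hed.1, Nat.succ_le_succ hed.2⟩) this

/-- The row of the bead and the column of the gap meet in a node of the diagram because the gap lies
above the bead; the hook length there is the distance `p`. -/
theorem exists_mem_hookLength_eq {lam : YoungDiagram} {p : ℕ} (hp : 0 < p) {x : ℤ}
    (hx : x ∈ beads lam) (hxp : x - p ∉ beads lam) :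
    ∃ a b : ℕ, (a, b) ∈ lam ∧ hookLength lam (a, b) = p ∧
      x = (lam.rowLen a : ℤ) - ((a : ℤ) + 1) ∧ x - p = (b : ℤ) - lam.colLen b := by
  obtain ⟨a, rfl⟩ := hx
  obtain ⟨b, hb⟩ := notMem_beads_iff.1 hxp
  dsimp only at hb
  have hab : (a, b) ∈ lam := by
    have h1 : (a, b) ∈ lam ↔ b < lam.rowLen a := YoungDiagram.mem_iff_lt_rowLen
    have h2 : (a, b) ∈ lam ↔ a < lam.colLen b := YoungDiagram.mem_iff_lt_colLen
    have h3 := h1.symm.trans h2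
    rw [h1]
    omega
  have := hookLength_eq hab
  exact ⟨a, b, hab, by omega, rfl, hb⟩

/-- Removing a rim hook of length `p` is moving a bead up one position on its runner; the leg
length is the number of beads passed. -/
theorem removesRimHook_iff {p : ℕ} (hp : 0 < p) {lam mu : YoungDiagram} {leg : ℕ} :
    RemovesRimHook p lam mu leg ↔ ∃ x ∈ beads lam, x - p ∉ beads lam ∧
      beads mu = insert (x - p) (beads lam \ {x}) ∧
      leg = {z | z ∈ beads lam ∧ x - p < z ∧ z < x}.ncard := by
  constructor
  · rintro ⟨⟨a, b⟩, hc, hh, hl, hmu⟩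
    rw [YoungDiagram.mem_cells] at hc
    have hhook := hookLength_eq hc
    have hgap : ((lam.rowLen a : ℤ) - ((a : ℤ) + 1)) - p = (b : ℤ) - lam.colLen b := by
      omega
    refine ⟨(lam.rowLen a : ℤ) - ((a : ℤ) + 1), ⟨a, rfl⟩, ?_, ?_, ?_⟩
    · exact notMem_beads_iff.2 ⟨b, hgap⟩
    · rw [hgap, beads_of_cells_eq_sdiff_rimHook hc hmu]
    · rw [hgap, ← hl, legLength_eq]
  · rintro ⟨x, hx, hxp, hmu, hl⟩
    obtain ⟨a, b, hab, hh, ha, hb⟩ := exists_mem_hookLength_eq hp hx hxp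
    refine ⟨(a, b), hab, hh, ?_, ?_⟩
    · rw [legLength_eq, hl, hb, ha]
    · obtain ⟨nu, hnu⟩ := exists_cells_eq_sdiff_rimHook lam (a, b)
      have h1 := beads_of_cells_eq_sdiff_rimHook hab hnu
      rw [← ha, ← hb, ← hmu] at h1
      rw [← beads_injective h1, hnu]

theorem sub_mem_beads_of_isCore {p : ℕ} (hp : 0 < p) {gam : YoungDiagram} (h : IsCore p gam)
    {x : ℤ} (hx : x ∈ beads gam) : x - p ∈ beads gam := by
  by_contra hxp
  obtain ⟨a, b, hab, hh, -⟩ := exists_mem_hookLength_eq hp hx hxp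
  exact h (a, b) hab hh

/-! ### Moving a bead down -/

theorem exists_rowLen_eq {r : ℕ → ℕ} (hr : Antitone r) {N : ℕ} (hN : r N = 0) :
    ∃ mu : YoungDiagram, ∀ i, mu.rowLen i = r i := by
  have hlt : ∀ i j, j < r i → i < N := by
    intro i j hj
    by_contra hi
    have := hr (not_lt.1 hi)
    omega
  refine ⟨⟨(Finset.range N ×ˢ Finset.range (r 0)).filter fun d => d.2 < r d.1, ?_⟩, fun i => ?_⟩
  · intro d e hed hd
    simp only [Finset.coe_filter, Finset.mem_product, Finset.mem_range, Set.mem_ofPred_eq] at hd ⊢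
    have h1 := hr hed.1
    have h2 := hed.1
    have h3 := hed.2
    omega
  · refine rowLen_eq_of_forall fun j => ?_
    rw [← YoungDiagram.mem_cells]
    simp only [Finset.mem_filter, Finset.mem_product, Finset.mem_range]
    have h1 := hlt i j
    have h2 := hr (Nat.zero_le i)
    omega

/-- A bead can be moved down to any position without a bead. -/
theorem exists_beads_eq_insert {lam : YoungDiagram} {x y : ℤ} (hx : x ∈ beads lam)
    (hy : y ∉ beads lam) (hxy : x < y) :
    ∃ mu : YoungDiagram, beads mu = insert y (beads lam \ {x}) := by
  obtain ⟨a, rfl⟩ := hx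
  obtain ⟨n, h1, h2⟩ := exists_row_of_notMem_beads hy
  dsimp only at hxy
  have hna : n ≤ a := by
    by_contra hna
    have := h1 a (by omega)
    omega
  have hanti : ∀ i, lam.rowLen (i + 1) ≤ lam.rowLen i := fun i =>
    lam.rowLen_anti _ _ (Nat.le_succ i)
  have hn := h2 n le_rfl
  -- The bead at `y` takes index `n`. The old rows `n, …, a - 1` move down one index and gain one
  -- node, which keeps their beads, and the bead of row `a` is dropped.
  let r : ℕ → ℕ := fun i => if i < n then lam.rowLen i else if i = n then (y + n + 1).toNat
    else if i ≤ a then lam.rowLen (i - 1) + 1 else lam.rowLen i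
  have r1 : ∀ i < n, r i = lam.rowLen i := fun i hi => if_pos hi
  have r2 : (r n : ℤ) = y + n + 1 := by
    simp only [r, lt_irrefl, if_false, if_true]; omega
  have r3 : ∀ i, n ≤ i → i < a → r (i + 1) = lam.rowLen i + 1 := by
    intro i hi hi'
    simp only [r]
    rw [if_neg (by omega), if_neg (by omega), if_pos (by omega), Nat.add_sub_cancel]
  have r4 : ∀ i, a < i → r i = lam.rowLen i := by
    intro i hi
    simp only [r]
    rw [if_neg (by omega), if_neg (by omega), if_neg (by omega)]
  have hr : Antitone r := by
    refine antitone_nat_of_succ_le fun i => ?_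
    have hi1 := hanti i
    rcases lt_trichotomy (i + 1) n with hi | hi | hi
    · rw [r1 _ hi, r1 _ (by omega)]; exact hi1
    · have h3 := h1 i (by omega)
      have h4 := r1 i (by omega)
      have h5 : r (i + 1) = r n := by rw [hi]
      omega
    · rcases lt_or_ge i a with hia | hia
      · have h3 := r3 i (by omega) hia
        rcases eq_or_ne i n with hin | hin
        · have h5 : r i = r n := by rw [hin]
          have h6 : lam.rowLen i = lam.rowLen n := by rw [hin]
          omega
        · have h4 := r3 (i - 1) (by omega) (by omega)
          have h5 := hanti (i - 1)
          rw [Nat.sub_add_cancel (by omega)] at h4 h5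
          omega
      · have h3 := r4 (i + 1) (by omega)
        rcases eq_or_ne i n with hin | hin
        · have h5 : r i = r n := by rw [hin]
          have h6 : lam.rowLen i = lam.rowLen n := by rw [hin]
          omega
        · rcases eq_or_ne i a with hia' | hia'
          · have h4 := r3 (i - 1) (by omega) (by omega)
            have h5 := hanti (i - 1)
            rw [Nat.sub_add_cancel (by omega)] at h4 h5
            omega
          · rw [h3, r4 i (by omega)]; exact hi1
  have hN : r (a + 1 + lam.colLen 0) = 0 := by
    rw [r4 _ (by omega)]
    by_contra h
    have h3 : (a + 1 + lam.colLen 0, 0) ∈ lam :=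
      YoungDiagram.mem_iff_lt_rowLen.2 (Nat.pos_of_ne_zero h)
    have := YoungDiagram.mem_iff_lt_colLen.1 h3
    omega
  obtain ⟨mu, hmu⟩ := exists_rowLen_eq hr hN
  refine ⟨mu, ?_⟩
  ext z
  simp only [Set.mem_insert_iff, Set.mem_sdiff, Set.mem_singleton_iff]
  constructor
  · rintro ⟨i, rfl⟩
    dsimp only
    rw [hmu]
    rcases lt_trichotomy i n with hi | rfl | hi
    · right
      rw [r1 i hi]
      exact ⟨⟨i, rfl⟩, (bead_strictAnti lam (show i < a by omega)).ne'⟩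
    · left; omega
    · right
      rcases le_or_gt i a with hia | hia
      · have h3 := r3 (i - 1) (by omega) (by omega)
        rw [Nat.sub_add_cancel (by omega)] at h3
        have h4 : ((r i : ℤ) - ((i : ℤ) + 1)) =
            (lam.rowLen (i - 1) : ℤ) - (((i - 1 : ℕ) : ℤ) + 1) := by omega
        rw [h4]
        exact ⟨⟨i - 1, rfl⟩, (bead_strictAnti lam (show i - 1 < a by omega)).ne'⟩
      · rw [r4 i hia]
        exact ⟨⟨i, rfl⟩, (bead_strictAnti lam hia).ne⟩
  · rintro (rfl | ⟨⟨i, rfl⟩, hne⟩)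
    · refine ⟨n, ?_⟩
      dsimp only
      rw [hmu]; omega
    · have hia : i ≠ a := by rintro rfl; exact hne rfl
      rcases lt_or_ge i n with hi | hi
      · exact ⟨i, by dsimp only; rw [hmu, r1 i hi]⟩
      rcases lt_or_ge i a with hi' | hi'
      · refine ⟨i + 1, ?_⟩
        dsimp only
        rw [hmu, r3 i hi hi']
        push_cast
        ring
      · exact ⟨i, by dsimp only; rw [hmu, r4 i (by omega)]⟩

/-! ### The lowest beads of a core -/

theorem mem_beads_of_lt {lam : YoungDiagram} {x : ℤ} (hx : x < -(lam.colLen 0 : ℤ)) :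
    x ∈ beads lam := by
  by_contra h
  obtain ⟨b, rfl⟩ := notMem_beads_iff.1 h
  have := lam.colLen_anti 0 b (Nat.zero_le b)
  omega

theorem lt_rowLen_of_mem_beads {lam : YoungDiagram} {x : ℤ} (hx : x ∈ beads lam) :
    x < lam.rowLen 0 := by
  obtain ⟨i, rfl⟩ := hx
  have := lam.rowLen_anti 0 i (Nat.zero_le i)
  dsimp only
  omega

theorem bddAbove_beads_runner (p : ℕ) (gam : YoungDiagram) (r : ℕ) :
    BddAbove {x : ℤ | x ∈ beads gam ∧ x ≡ (r : ℤ) [ZMOD (p : ℤ)]} :=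
  ⟨gam.rowLen 0, fun _ hx => (lt_rowLen_of_mem_beads hx.1).le⟩

theorem lowestBead_mem {p : ℕ} (hp : 0 < p) (gam : YoungDiagram) (r : ℕ) :
    lowestBead p gam r ∈ beads gam ∧ lowestBead p gam r ≡ (r : ℤ) [ZMOD (p : ℤ)] := by
  refine Int.csSup_mem ?_ (bddAbove_beads_runner p gam r)
  -- Every position before `-colLen 0` has a bead; this one is congruent to `r` and, as `p ≥ 1`,
  -- lies in that range.
  refine ⟨(r : ℤ) - p * (gam.colLen 0 + r + 1), mem_beads_of_lt ?_, ?_⟩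
  · have : (1 : ℤ) ≤ p := by exact_mod_cast hp
    have h2 : (0 : ℤ) ≤ (p - 1) * (gam.colLen 0 + r + 1) :=
      mul_nonneg (by omega) (by omega)
    linarith
  · exact (Int.modEq_iff_dvd.2 ⟨gam.colLen 0 + r + 1, by ring⟩)

theorem le_lowestBead {p : ℕ} {gam : YoungDiagram} {r : ℕ} {x : ℤ} (hx : x ∈ beads gam)
    (hr : x ≡ (r : ℤ) [ZMOD (p : ℤ)]) : x ≤ lowestBead p gam r :=
  le_csSup (bddAbove_beads_runner p gam r) ⟨hx, hr⟩

/-- Lowest beads of different runners have different residues. The sorted list thus has length `p`,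
and the default value in `rho` is never reached for `i < p`. -/
theorem card_image_lowestBead {p : ℕ} (hp : 0 < p) (gam : YoungDiagram) :
    ((Finset.range p).image (lowestBead p gam)).card = p := by
  rw [Finset.card_image_of_injOn, Finset.card_range]
  intro r hr s hs hrs
  have h1 := (lowestBead_mem hp gam r).2.symm.trans
    (hrs ▸ (lowestBead_mem hp gam s).2 : lowestBead p gam r ≡ s [ZMOD p])
  rw [Finset.coe_range, Set.mem_Iio] at hr hs
  exact Nat.ModEq.eq_of_lt_of_lt (Int.natCast_modEq_iff.1 h1) hr hs

theorem length_sort_lowestBead {p : ℕ} (hp : 0 < p) (gam : YoungDiagram) :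
    (((Finset.range p).image (lowestBead p gam)).sort (· ≤ ·)).length = p := by
  rw [Finset.length_sort, card_image_lowestBead hp]

theorem rho_eq_getElem {p : ℕ} (hp : 0 < p) (gam : YoungDiagram) {i : ℕ} (hi : i < p) :
    rho p gam i = (((Finset.range p).image (lowestBead p gam)).sort (· ≤ ·))[i]'(by
      rwa [length_sort_lowestBead hp]) :=
  List.getD_eq_getElem _ _ _

theorem rho_lt_rho {p : ℕ} (hp : 0 < p) (gam : YoungDiagram) {i j : ℕ} (hij : i < j)
    (hj : j < p) : rho p gam i < rho p gam j := by
  rw [rho_eq_getElem hp gam (hij.trans hj), rho_eq_getElem hp gam hj]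
  exact (Finset.sortedLT_sort _).getElem_lt_getElem_of_lt hij

theorem rho_lt_rho_iff {p : ℕ} (hp : 0 < p) (gam : YoungDiagram) {i j : ℕ} (hi : i < p)
    (hj : j < p) : rho p gam i < rho p gam j ↔ i < j := by
  refine ⟨fun h => ?_, fun h => rho_lt_rho hp gam h hj⟩
  by_contra hij
  rcases (not_lt.1 hij).eq_or_lt with rfl | h'
  · exact h.false
  · exact h.asymm (rho_lt_rho hp gam h' hi)

theorem exists_rho_eq {p : ℕ} (hp : 0 < p) (gam : YoungDiagram) {i : ℕ} (hi : i < p) :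
    ∃ r, rho p gam i = lowestBead p gam r := by
  have h : rho p gam i ∈ ((Finset.range p).image (lowestBead p gam)).sort (· ≤ ·) := by
    rw [rho_eq_getElem hp gam hi]
    exact List.getElem_mem _
  rw [Finset.mem_sort, Finset.mem_image] at h
  obtain ⟨r, -, hr⟩ := h
  exact ⟨r, hr.symm⟩

theorem exists_modEq_rho {p : ℕ} (hp : 0 < p) (gam : YoungDiagram) (x : ℤ) :
    ∃ i < p, x ≡ rho p gam i [ZMOD p] := by
  have hp' : (0 : ℤ) < p := by exact_mod_cast hp
  obtain ⟨r, hr⟩ : ∃ r : ℕ, (r : ℤ) = x % p :=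
    ⟨(x % p).toNat, Int.toNat_of_nonneg (Int.emod_nonneg _ hp'.ne')⟩
  have hrp : r < p := by
    have := Int.emod_lt_of_pos x hp'
    omega
  have h : lowestBead p gam r ∈ ((Finset.range p).image (lowestBead p gam)).sort (· ≤ ·) := by
    rw [Finset.mem_sort]
    exact Finset.mem_image_of_mem _ (Finset.mem_range.2 hrp)
  obtain ⟨i, hi, hir⟩ := List.getElem_of_mem h
  rw [length_sort_lowestBead hp] at hi
  refine ⟨i, hi, ?_⟩
  rw [rho_eq_getElem hp gam hi, hir]
  refine Int.ModEq.trans ?_ (lowestBead_mem hp gam r).2.symm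
  rw [hr]
  exact (Int.mod_modEq x p).symm

theorem rho_mem_beads {p : ℕ} (hp : 0 < p) (gam : YoungDiagram) {i : ℕ} (hi : i < p) :
    rho p gam i ∈ beads gam := by
  obtain ⟨r, hr⟩ := exists_rho_eq hp gam hi
  rw [hr]
  exact (lowestBead_mem hp gam r).1

theorem le_rho_of_mem_beads {p : ℕ} (hp : 0 < p) {gam : YoungDiagram} {i : ℕ} (hi : i < p)
    {x : ℤ} (hx : x ≡ rho p gam i [ZMOD p]) (h : x ∈ beads gam) : x ≤ rho p gam i := by
  obtain ⟨r, hr⟩ := exists_rho_eq hp gam hi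
  rw [hr] at hx ⊢
  exact le_lowestBead h (hx.trans (lowestBead_mem hp gam r).2)

theorem eq_of_rho_modEq {p : ℕ} (hp : 0 < p) {gam : YoungDiagram} {i j : ℕ} (hi : i < p)
    (hj : j < p) (h : rho p gam i ≡ rho p gam j [ZMOD p]) : i = j := by
  have h1 := le_rho_of_mem_beads hp hj h (rho_mem_beads hp gam hi)
  have h2 := le_rho_of_mem_beads hp hi h.symm (rho_mem_beads hp gam hj)
  have h3 := rho_lt_rho_iff hp gam hi hj
  have h4 := rho_lt_rho_iff hp gam hj hi
  omega

/-- In a core every bead has a bead `p` positions before it, so descending from `ρ_i` fills the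
whole runner. -/
theorem mem_beads_iff_le_rho {p : ℕ} (hp : 0 < p) {gam : YoungDiagram} (hcore : IsCore p gam)
    {i : ℕ} (hi : i < p) {x : ℤ} (hx : x ≡ rho p gam i [ZMOD p]) :
    x ∈ beads gam ↔ x ≤ rho p gam i := by
  refine ⟨le_rho_of_mem_beads hp hi hx, fun hle => ?_⟩
  have hp' : (0 : ℤ) < p := by exact_mod_cast hp
  have hmul : ∀ n : ℕ, rho p gam i - n * p ∈ beads gam := by
    intro n
    induction n with
    | zero => simpa using rho_mem_beads hp gam hi
    | succ n ih =>
      have := sub_mem_beads_of_isCore hp hcore ih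
      convert this using 1
      push_cast
      ring
  obtain ⟨c, hc⟩ := hx.dvd
  have hc0 : 0 ≤ c := by
    by_contra h
    have := mul_neg_of_pos_of_neg hp' (not_le.1 h)
    omega
  obtain ⟨n, rfl⟩ := Int.eq_ofNat_of_zero_le hc0
  have := hmul n
  convert this using 1
  linarith

/-- Between two consecutive positions of a runner there is one position on each other runner, and
it has a bead if and only if the lowest bead of that runner is further down. -/
theorem ncard_beads_between {p : ℕ} (hp : 0 < p) {gam : YoungDiagram} (hcore : IsCore p gam)
    {i : ℕ} (hi : i < p) {y : ℤ} (hy : y ≡ rho p gam i [ZMOD p]) :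
    {z | z ∈ beads gam ∧ y < z ∧ z < y + p}.ncard =
      ((Finset.range p).filter fun j => j ≠ i ∧ y < rho p gam j).card := by
  have hp' : (0 : ℤ) < p := by exact_mod_cast hp
  -- `f j` is the unique position of runner `j` in `[y, y + p)`.
  let f : ℕ → ℤ := fun j => y + (rho p gam j - y) % p
  have hf : ∀ j, f j ≡ rho p gam j [ZMOD p] := fun j => by
    have h := (Int.mod_modEq (rho p gam j - y) p).add_left y
    simpa [f] using h
  have hf1 : ∀ j, y ≤ f j := fun j => by
    have := Int.emod_nonneg (rho p gam j - y) hp'.ne'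
    simp only [f]; omega
  have hf2 : ∀ j, f j < y + p := fun j => by
    have := Int.emod_lt_of_pos (rho p gam j - y) hp'
    simp only [f]; omega
  have hinj : Set.InjOn f ((Finset.range p).filter fun j => j ≠ i ∧ y < rho p gam j) := by
    intro j hj k hk hjk
    simp only [Finset.coe_filter, Finset.mem_range, Set.mem_ofPred_eq] at hj hk
    exact eq_of_rho_modEq hp hj.1 hk.1 (((hf j).symm.trans (by rw [hjk])).trans (hf k))
  rw [← Set.ncard_coe_finset, ← hinj.ncard_image]
  congr 1
  ext z
  simp only [Set.mem_ofPred_eq, Set.mem_image, Finset.coe_filter, Finset.mem_range]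
  constructor
  · rintro ⟨hz, h1, h2⟩
    obtain ⟨j, hj, hzj⟩ := exists_modEq_rho hp gam z
    have hle := (mem_beads_iff_le_rho hp hcore hj hzj).1 hz
    refine ⟨j, ⟨hj, ?_, by omega⟩, ?_⟩
    · rintro rfl
      have h3 := Int.le_of_dvd (by omega) (hy.trans hzj.symm).dvd
      omega
    · have h3 : (rho p gam j - y) % p = z - y := by
        rw [← (hzj.sub_right y).eq]
        exact Int.emod_eq_of_lt (by omega) (by omega)
      simp only [f]; omega
  · rintro ⟨j, ⟨hj, hji, hyj⟩, rfl⟩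
    have hne : f j ≠ y := fun h => hji
      (eq_of_rho_modEq hp hj hi ((hf j).symm.trans (by rw [h]; exact hy)))
    have h1 := hf1 j
    refine ⟨(mem_beads_iff_le_rho hp hcore hj (hf j)).2 ?_, by omega, hf2 j⟩
    -- Otherwise `f j ≥ ρ_j + p > y + p`, outside the window.
    by_contra hlt
    have h3 := Int.le_of_dvd (by omega) (hf j).symm.dvd
    have h4 := hf2 j
    omega

/-! ### The leg lengths in the block of weight two -/

theorem rho_add_notMem_beads {p : ℕ} (hp : 0 < p) (gam : YoungDiagram) {i : ℕ} (hi : i < p) :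
    rho p gam i + p ∉ beads gam := by
  intro h
  have := le_rho_of_mem_beads hp hi (Int.modEq_iff_dvd.2 ⟨-1, by ring⟩) h
  omega

theorem finite_beads_between (S : Set ℤ) (x y : ℤ) : {z | z ∈ S ∧ x < z ∧ z < y}.Finite :=
  (Set.finite_Ioo x y).subset fun _ hz => hz.2

theorem ncard_beads_below_rho {p : ℕ} (hp : 0 < p) {gam : YoungDiagram} (hcore : IsCore p gam)
    {i : ℕ} (hi : i < p) :
    {z | z ∈ beads gam ∧ rho p gam i < z ∧ z < rho p gam i + p}.ncard = p - 1 - i := by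
  rw [ncard_beads_between hp hcore hi rfl]
  have : ((Finset.range p).filter fun j => j ≠ i ∧ rho p gam i < rho p gam j) =
      Finset.Ioo i p := by
    ext j
    simp only [Finset.mem_filter, Finset.mem_range, Finset.mem_Ioo]
    constructor
    · rintro ⟨hj, -, h⟩
      exact ⟨(rho_lt_rho_iff hp gam hi hj).1 h, hj⟩
    · rintro ⟨h, hj⟩
      exact ⟨hj, h.ne', rho_lt_rho hp gam h hj⟩
  rw [this, Nat.card_Ioo]
  omega

/-- The partition of weight one obtained by moving the lowest bead of a runner. -/
theorem exists_weight_one {p : ℕ} (hp : 0 < p) (gam : YoungDiagram) {j : ℕ} (hj : j < p) :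
    ∃ mu : YoungDiagram, beads mu = insert (rho p gam j + p) (beads gam \ {rho p gam j}) :=
  exists_beads_eq_insert (rho_mem_beads hp gam hj) (rho_add_notMem_beads hp gam hj) (by omega)

theorem removesRimHook_weight_one_iff {p : ℕ} (hp : 0 < p) {gam : YoungDiagram}
    (hcore : IsCore p gam) {j : ℕ} (hj : j < p) {mu : YoungDiagram}
    (hmu : beads mu = insert (rho p gam j + p) (beads gam \ {rho p gam j})) {leg : ℕ} :
    RemovesRimHook p mu gam leg ↔ leg = p - 1 - j := by
  have hmem := rho_mem_beads hp gam hj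
  have hnot := rho_add_notMem_beads hp gam hj
  have hcount : {z | z ∈ beads mu ∧ rho p gam j + p - p < z ∧ z < rho p gam j + p}.ncard =
      p - 1 - j := by
    rw [← ncard_beads_below_rho hp hcore hj, hmu]
    congr 1
    ext z
    simp only [Set.mem_ofPred_eq, Set.mem_insert_iff, Set.mem_sdiff, Set.mem_singleton_iff,
      add_sub_cancel_right]
    constructor
    · rintro ⟨h | h, h1, h2⟩
      · omega
      · exact ⟨h.1, h1, h2⟩
    · rintro ⟨h, h1, h2⟩
      exact ⟨Or.inr ⟨h, h1.ne'⟩, h1, h2⟩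
  rw [removesRimHook_iff hp]
  constructor
  · rintro ⟨x, hx, hxp, hg, hl⟩
    -- The position `ρ_j + p` is a gap of the core, so its bead must be the one that moves.
    have hxj : x = rho p gam j + p := by
      by_contra hne
      apply hnot
      rw [hg, hmu]
      exact Or.inr ⟨Or.inl rfl, fun h => hne h.symm⟩
    rw [hl, hxj, hcount]
  · rintro rfl
    refine ⟨rho p gam j + p, ?_, ?_, ?_, hcount.symm⟩
    · rw [hmu]; exact Or.inl rfl
    · rw [hmu, add_sub_cancel_right]
      rintro (h | h)
      · omega
      · exact h.2 rfl
    · rw [hmu, add_sub_cancel_right]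
      ext z
      simp only [Set.mem_insert_iff, Set.mem_sdiff, Set.mem_singleton_iff]
      constructor
      · intro hz
        by_cases h : z = rho p gam j
        · exact Or.inl h
        · exact Or.inr ⟨Or.inr ⟨hz, h⟩, fun h' => hnot (h' ▸ hz)⟩
      · rintro (rfl | ⟨h | h, h'⟩)
        · exact hmem
        · exact absurd h h'
        · exact h.1

/-- A criterion for membership in `∂_l` in terms of the first bead that is moved up. -/
theorem mem_drond_of_beads {p : ℕ} (hp : 0 < p) {gam : YoungDiagram} (hcore : IsCore p gam)
    {lam : YoungDiagram} {L : Set ℤ} (hL : beads lam = L) {l : ℕ} (hex : ∃ x ∈ L, x - p ∉ L)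
    (hall : ∀ x ∈ L, x - p ∉ L → ∃ j < p,
      insert (x - p) (L \ {x}) = insert (rho p gam j + p) (beads gam \ {rho p gam j}) ∧
      ({z | z ∈ L ∧ x - p < z ∧ z < x}.ncard = p - 1 - j + l ∨
        {z | z ∈ L ∧ x - p < z ∧ z < x}.ncard + l = p - 1 - j)) :
    lam ∈ drond p gam l := by
  subst hL
  constructor
  · obtain ⟨x, hx, hxp⟩ := hex
    obtain ⟨j, hj, heq, -⟩ := hall x hx hxp
    obtain ⟨mu, hmu⟩ := exists_weight_one hp gam hj
    exact ⟨mu, _, (removesRimHook_iff hp).2 ⟨x, hx, hxp, hmu.trans heq.symm, rfl⟩, gam, _,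
      (removesRimHook_weight_one_iff hp hcore hj hmu).2 rfl, rfl⟩
  · intro mu l₁ l₂ h1 h2
    obtain ⟨x, hx, hxp, hmu, hl₁⟩ := (removesRimHook_iff hp).1 h1
    obtain ⟨j, hj, heq, hl⟩ := hall x hx hxp
    rw [← hl₁, ← (removesRimHook_weight_one_iff hp hcore hj (hmu.trans heq)).1 h2] at hl
    rw [abs_eq (Int.natCast_nonneg l)]
    omega

/-- `ofBeads` is a choice of preimage, meaningful only on the range of `beads`; hence each label
needs a diagram with the prescribed beads. -/
theorem beads_ofBeads {B : Set ℤ} (h : ∃ lam, beads lam = B) : beads (ofBeads B) = B :=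
  Function.invFun_eq h

theorem pyramid_eq_one_iff {p : ℕ} {gam : YoungDiagram} {i j : ℕ} (hij : i ≤ j) :
    pyramid p gam i j = 1 ↔ j < p ∧ rho p gam j - rho p gam i < p := by
  unfold pyramid
  split_ifs <;> simp <;> omega

theorem pyramid_eq_zero_iff {p : ℕ} {gam : YoungDiagram} {i j : ℕ} (hij : i ≤ j) :
    pyramid p gam i j = 0 ↔ (j < p → (p : ℤ) ≤ rho p gam j - rho p gam i) := by
  unfold pyramid
  split_ifs <;> simp <;> omega

theorem beads_lrPair {p : ℕ} (hp : 0 < p) (gam : YoungDiagram) {i j : ℕ} (hij : i < j)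
    (hj : j < p) : beads (lrPair p gam i j) =
      (beads gam \ {rho p gam i, rho p gam j}) ∪ {rho p gam i + p, rho p gam j + p} := by
  apply beads_ofBeads
  have hlt := rho_lt_rho hp gam hij hj
  have hnj := rho_add_notMem_beads hp gam hj
  obtain ⟨mu, hmu⟩ := exists_weight_one hp gam (hij.trans hj)
  obtain ⟨lam, hlam⟩ := exists_beads_eq_insert (lam := mu) (x := rho p gam j)
    (y := rho p gam j + p) (by rw [hmu]; exact Or.inr ⟨rho_mem_beads hp gam hj, hlt.ne'⟩)
    (by
      rw [hmu]
      rintro (h | h)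
      · omega
      · exact hnj h.1) (by omega)
  refine ⟨lam, ?_⟩
  rw [hlam, hmu]
  have hni := rho_add_notMem_beads hp gam (hij.trans hj)
  have hne : rho p gam i + p ≠ rho p gam j := fun h => hni (h ▸ rho_mem_beads hp gam hj)
  ext z
  simp only [Set.mem_insert_iff, Set.mem_sdiff, Set.mem_singleton_iff, Set.mem_union, not_or]
  constructor
  · rintro (h | ⟨h | h, h'⟩)
    · exact Or.inr (Or.inr h)
    · exact Or.inr (Or.inl h)
    · exact Or.inl ⟨h.1, h.2, h'⟩
  · rintro (⟨h, h1, h2⟩ | h | h)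
    · exact Or.inr ⟨Or.inr ⟨h, h1⟩, h2⟩
    · exact Or.inr ⟨Or.inl h, fun h' => hne (h.symm.trans h')⟩
    · exact Or.inl h

-- Only the two displaced beads can move up. If the bead of runner `i` goes first, the gap left at
-- `ρ_j` lowers its leg by one when `ρ_j < ρ_i + p`. If that of runner `j` goes first, the bead at
-- `ρ_i + p` raises its leg by one under the same condition. Both orders give the same difference.
set_option maxHeartbeats 800000 in
theorem lrPair_mem_drond {p : ℕ} (hp : 0 < p) {gam : YoungDiagram} (hcore : IsCore p gam)
    {i j : ℕ} (hij : i < j) (hj : j < p) :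
    lrPair p gam i j ∈ drond p gam (j - i - pyramid p gam i j) := by
  have hi := hij.trans hj
  have hbeads := beads_lrPair hp gam hij hj
  have hlt := rho_lt_rho hp gam hij hj
  have hni := rho_add_notMem_beads hp gam hi
  have hnj := rho_add_notMem_beads hp gam hj
  have hbi := rho_mem_beads hp gam hi
  have hbj := rho_mem_beads hp gam hj
  have hci := ncard_beads_below_rho hp hcore hi
  have hcj := ncard_beads_below_rho hp hcore hj
  have hsub : ∀ x ∈ beads gam, x - p ∈ beads gam := fun x => sub_mem_beads_of_isCore hp hcore
  have h1 := pyramid_eq_one_iff (p := p) (gam := gam) hij.le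
  have h0 := pyramid_eq_zero_iff (p := p) (gam := gam) hij.le
  set L := beads (lrPair p gam i j) with hL
  set a := rho p gam i with ha
  set b := rho p gam j with hb
  have hne : a + p ≠ b := fun h => hni (h ▸ hbj)
  have hmem : ∀ z, z ∈ L ↔ (z ∈ beads gam ∧ z ≠ a ∧ z ≠ b) ∨ z = a + p ∨ z = b + p := by
    intro z
    rw [hbeads]
    simp only [Set.mem_union, Set.mem_sdiff, Set.mem_insert_iff, Set.mem_singleton_iff, not_or]
  have haL : a ∉ L := by rw [hmem]; omega
  have hbL : b ∉ L := by rw [hmem]; omega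
  refine mem_drond_of_beads hp hcore hL.symm ⟨a + p, (hmem _).2 (by omega), ?_⟩ ?_
  · rwa [add_sub_cancel_right]
  intro x hx hxp
  -- An undisplaced bead could move up only into `a` or `b`, so it would stand at `a + p` or `b +
  -- p`, which are gaps of the core.
  have hx' : x = a + p ∨ x = b + p := by
    rcases (hmem x).1 hx with h | h
    · have h2 := hsub x h.1
      rw [hmem] at hxp
      have h3 : x - p = a ∨ x - p = b := by tauto
      rcases h3 with h3 | h3
      · exact absurd h.1 (by rwa [show x = a + p by omega])
      · exact absurd h.1 (by rwa [show x = b + p by omega])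
    · exact h
  rcases hx' with rfl | rfl
  · refine ⟨j, hj, ?_, ?_⟩
    · rw [← hb, add_sub_cancel_right]
      ext z
      simp only [Set.mem_insert_iff, Set.mem_sdiff, Set.mem_singleton_iff, hmem]
      grind
    · rw [add_sub_cancel_right]
      rcases lt_or_gt_of_ne hne with hgt | hgt
      · have hset : {z | z ∈ L ∧ a < z ∧ z < a + p} =
            {z | z ∈ beads gam ∧ a < z ∧ z < a + p} := by
          ext z
          simp only [Set.mem_ofPred_eq, hmem]
          constructor
          · rintro ⟨h, h2⟩
            exact ⟨by rcases h with h | h | h <;> [exact h.1; omega; omega], h2⟩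
          · rintro ⟨h, h2⟩
            exact ⟨Or.inl ⟨h, by omega, by omega⟩, h2⟩
        rw [hset, hci]
        omega
      · have hset : {z | z ∈ L ∧ a < z ∧ z < a + p} =
            {z | z ∈ beads gam ∧ a < z ∧ z < a + p} \ {b} := by
          ext z
          simp only [Set.mem_ofPred_eq, hmem, Set.mem_sdiff, Set.mem_singleton_iff]
          constructor
          · rintro ⟨h, h2⟩
            rcases h with h | h | h <;> [exact ⟨⟨h.1, h2⟩, h.2.2⟩; omega; omega]
          · rintro ⟨⟨h, h2⟩, h3⟩
            exact ⟨Or.inl ⟨h, by omega, h3⟩, h2⟩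
        have hbm : b ∈ {z | z ∈ beads gam ∧ a < z ∧ z < a + p} := ⟨hbj, hlt, hgt⟩
        rw [hset, Set.ncard_sdiff_singleton_of_mem hbm, hci]
        omega
  · refine ⟨i, hi, ?_, ?_⟩
    · rw [← ha, add_sub_cancel_right]
      ext z
      simp only [Set.mem_insert_iff, Set.mem_sdiff, Set.mem_singleton_iff, hmem]
      grind
    · rw [add_sub_cancel_right]
      rcases lt_or_gt_of_ne hne with hgt | hgt
      · have hset : {z | z ∈ L ∧ b < z ∧ z < b + p} =
            {z | z ∈ beads gam ∧ b < z ∧ z < b + p} := by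
          ext z
          simp only [Set.mem_ofPred_eq, hmem]
          constructor
          · rintro ⟨h, h2⟩
            exact ⟨by rcases h with h | h | h <;> [exact h.1; omega; omega], h2⟩
          · rintro ⟨h, h2⟩
            exact ⟨Or.inl ⟨h, by omega, by omega⟩, h2⟩
        rw [hset, hcj]
        omega
      · have hset : {z | z ∈ L ∧ b < z ∧ z < b + p} =
            insert (a + p) {z | z ∈ beads gam ∧ b < z ∧ z < b + p} := by
          ext z
          simp only [Set.mem_ofPred_eq, hmem, Set.mem_insert_iff]
          constructor
          · rintro ⟨h, h2⟩
            rcases h with h | h | h <;> [exact Or.inr ⟨h.1, h2⟩; exact Or.inl h; omega]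
          · rintro (h | ⟨h, h2⟩)
            · exact ⟨Or.inr (Or.inl h), by omega⟩
            · exact ⟨Or.inl ⟨h, by omega, by omega⟩, h2⟩
        rw [hset, Set.ncard_insert_of_notMem (fun h => hni h.1) (finite_beads_between _ _ _), hcj]
        omega

theorem beads_lrOne {p : ℕ} (hp : 0 < p) {gam : YoungDiagram} (hcore : IsCore p gam) {i : ℕ}
    (hi : i < p) : beads (lrOne p gam i) =
      (beads gam \ {rho p gam i}) ∪ {rho p gam i + 2 * p} := by
  apply beads_ofBeads
  rw [Set.union_singleton]
  refine exists_beads_eq_insert (rho_mem_beads hp gam hi) (fun h => ?_) (by omega)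
  apply rho_add_notMem_beads hp gam hi
  convert sub_mem_beads_of_isCore hp hcore h using 1
  ring

/-- The first move passes one bead for each runner with `ρ_j > ρ_i + p`. The two pyramid entries say
that these are the runners after `m`; the default `0` covers `m + 1 = p`. -/
theorem lrOne_mem_drond {p : ℕ} (hp : 0 < p) {gam : YoungDiagram} (hcore : IsCore p gam)
    {i m : ℕ} (him : i ≤ m) (h1 : pyramid p gam i m = 1) (h0 : pyramid p gam i (m + 1) = 0) :
    lrOne p gam i ∈ drond p gam (m - i) := by
  rw [pyramid_eq_one_iff him] at h1
  rw [pyramid_eq_zero_iff (by omega)] at h0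
  obtain ⟨hm, hmi⟩ := h1
  have hi := him.trans_lt hm
  have hcount : {z | z ∈ beads gam ∧ rho p gam i + p < z ∧ z < rho p gam i + p + p}.ncard =
      p - 1 - m := by
    rw [ncard_beads_between hp hcore hi (Int.modEq_iff_dvd.2 ⟨-1, by ring⟩)]
    have : ((Finset.range p).filter fun j => j ≠ i ∧ rho p gam i + p < rho p gam j) =
        Finset.Ioo m p := by
      ext j
      simp only [Finset.mem_filter, Finset.mem_range, Finset.mem_Ioo]
      constructor
      · rintro ⟨hj, -, h⟩
        exact ⟨(rho_lt_rho_iff hp gam hm hj).1 (by omega), hj⟩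
      · rintro ⟨h, hj⟩
        have h2 := h0 (by omega)
        -- A zero entry gives only `ρ_i + p ≤ ρ_j`; equality is excluded because `ρ_i + p` is a gap.
        have h3 : rho p gam i + p ≠ rho p gam j := fun h =>
          rho_add_notMem_beads hp gam hi (h ▸ rho_mem_beads hp gam hj)
        have h4 := (rho_lt_rho_iff hp gam hj (show m + 1 < p by omega)).not
        exact ⟨hj, by omega, by omega⟩
    rw [this, Nat.card_Ioo]
    omega
  have hbeads := beads_lrOne hp hcore hi
  have hni := rho_add_notMem_beads hp gam hi
  have hbi := rho_mem_beads hp gam hi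
  have hsub : ∀ x ∈ beads gam, x - p ∈ beads gam := fun x => sub_mem_beads_of_isCore hp hcore
  set L := beads (lrOne p gam i) with hL
  set a := rho p gam i with ha
  have hmem : ∀ z, z ∈ L ↔ (z ∈ beads gam ∧ z ≠ a) ∨ z = a + 2 * p := by
    intro z
    rw [hbeads]
    simp only [Set.mem_union, Set.mem_sdiff, Set.mem_singleton_iff]
  have hn2 : a + 2 * p ∉ beads gam := fun h => hni (by convert hsub _ h using 1; ring)
  have hapL : a + p ∉ L := by
    rw [hmem]
    rintro (h | h)
    · exact hni h.1
    · omega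
  refine mem_drond_of_beads hp hcore hL.symm ⟨a + 2 * p, (hmem _).2 (Or.inr rfl), ?_⟩ ?_
  · rwa [show a + 2 * (p : ℤ) - p = a + p by ring]
  intro x hx hxp
  have hx' : x = a + 2 * p := by
    rcases (hmem x).1 hx with h | h
    · have h2 := hsub x h.1
      rw [hmem] at hxp
      have h3 : x - p = a := by tauto
      exact absurd h.1 (by rwa [show x = a + p by omega])
    · exact h
  subst hx'
  refine ⟨i, hi, ?_, ?_⟩
  · rw [← ha, show a + 2 * (p : ℤ) - p = a + p by ring]
    ext z
    simp only [Set.mem_insert_iff, Set.mem_sdiff, Set.mem_singleton_iff, hmem]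
    grind
  · have hset : {z | z ∈ L ∧ a + 2 * (p : ℤ) - p < z ∧ z < a + 2 * p} =
        {z | z ∈ beads gam ∧ a + p < z ∧ z < a + p + p} := by
      ext z
      simp only [Set.mem_ofPred_eq, hmem]
      constructor
      · rintro ⟨h, h2⟩
        rcases h with h | h
        · exact ⟨h.1, by omega, by omega⟩
        · omega
      · rintro ⟨h, h2⟩
        exact ⟨Or.inl ⟨h, by omega⟩, by omega, by omega⟩
    rw [hset, hcount]
    omega

/-- The two moves leave `ρ_i` occupied, so they amount to moving one bead from `ρ_i - p` to `ρ_i +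
p`. -/
theorem beads_lrSq {p : ℕ} (hp : 0 < p) {gam : YoungDiagram} (hcore : IsCore p gam) {i : ℕ}
    (hi : i < p) : beads (lrSq p gam i) =
      (beads gam \ {rho p gam i, rho p gam i - p}) ∪ {rho p gam i + p, rho p gam i} := by
  apply beads_ofBeads
  have hbi := rho_mem_beads hp gam hi
  obtain ⟨lam, hlam⟩ := exists_beads_eq_insert (sub_mem_beads_of_isCore hp hcore hbi)
    (rho_add_notMem_beads hp gam hi) (by omega)
  refine ⟨lam, ?_⟩
  rw [hlam]
  ext z
  simp only [Set.mem_insert_iff, Set.mem_sdiff, Set.mem_singleton_iff, Set.mem_union, not_or]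
  grind

/-- The bead at `ρ_j` must move up first, since it blocks the one at `ρ_j + p`. The pyramid entries
say that `ρ_s > ρ_j - p` exactly for `s > i`, and runner `j` itself is not counted. -/
theorem lrSq_mem_drond {p : ℕ} (hp : 0 < p) {gam : YoungDiagram} (hcore : IsCore p gam)
    {i j : ℕ} (hij : i < j) (hj : j < p) (h1 : pyramid p gam (i + 1) j = 1)
    (h0 : pyramid p gam i j = 0) :
    lrSq p gam j ∈ drond p gam (j - i - 1) := by
  rw [pyramid_eq_one_iff (show i + 1 ≤ j from hij)] at h1
  rw [pyramid_eq_zero_iff hij.le] at h0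
  have h0 := h0 hj
  have hi := hij.trans hj
  have hbeads := beads_lrSq hp hcore hj
  have hnj := rho_add_notMem_beads hp gam hj
  have hbj := rho_mem_beads hp gam hj
  have hcount : {z | z ∈ beads gam ∧ rho p gam j - p < z ∧ z < rho p gam j - p + p}.ncard =
      p - 1 - i - 1 := by
    rw [ncard_beads_between hp hcore hj (Int.modEq_iff_dvd.2 ⟨1, by ring⟩)]
    have : ((Finset.range p).filter fun s => s ≠ j ∧ rho p gam j - p < rho p gam s) =
        (Finset.Ioo i p).erase j := by
      ext s
      simp only [Finset.mem_filter, Finset.mem_range, Finset.mem_Ioo, Finset.mem_erase]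
      constructor
      · rintro ⟨hs, hsj, h⟩
        exact ⟨hsj, (rho_lt_rho_iff hp gam hi hs).1 (by omega), hs⟩
      · rintro ⟨hsj, h, hs⟩
        have h4 := (rho_lt_rho_iff hp gam hs (show i + 1 < p by omega)).not
        exact ⟨hs, hsj, by omega⟩
    rw [this, Finset.card_erase_of_mem (Finset.mem_Ioo.2 ⟨hij, hj⟩), Nat.card_Ioo]
    omega
  have hsub : ∀ x ∈ beads gam, x - p ∈ beads gam := fun x => sub_mem_beads_of_isCore hp hcore
  set L := beads (lrSq p gam j) with hL
  set a := rho p gam j with ha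
  have hmem : ∀ z, z ∈ L ↔ (z ∈ beads gam ∧ z ≠ a - p) ∨ z = a + p := by
    intro z
    rw [hbeads]
    simp only [Set.mem_union, Set.mem_sdiff, Set.mem_singleton_iff, Set.mem_insert_iff, not_or]
    grind
  have haL : a ∈ L := (hmem a).2 (Or.inl ⟨hbj, by omega⟩)
  refine mem_drond_of_beads hp hcore hL.symm ⟨a, haL, by rw [hmem]; omega⟩ ?_
  intro x hx hxp
  have hx' : x = a := by
    rcases (hmem x).1 hx with h | h
    · have h2 := hsub x h.1
      rw [hmem] at hxp
      have h3 : x - p = a - p := by tauto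
      omega
    · exact absurd haL (by rwa [show a = x - p by omega])
  subst hx'
  refine ⟨j, hj, ?_, ?_⟩
  · rw [← ha]
    ext z
    simp only [Set.mem_insert_iff, Set.mem_sdiff, Set.mem_singleton_iff, hmem]
    grind
  · have hset : {z | z ∈ L ∧ a - (p : ℤ) < z ∧ z < a} =
        {z | z ∈ beads gam ∧ a - p < z ∧ z < a - p + p} := by
      ext z
      simp only [Set.mem_ofPred_eq, hmem]
      constructor
      · rintro ⟨h, h2⟩
        rcases h with h | h
        · exact ⟨h.1, by omega, by omega⟩
        · omega
      · rintro ⟨h, h2⟩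
        exact ⟨Or.inl ⟨h, by omega⟩, by omega, by omega⟩
    rw [hset, hcount]
    omega

/-! ### The middle column of the pyramid -/

theorem pyramid_eq_zero_or_one (p : ℕ) (gam : YoungDiagram) (i j : ℕ) :
    pyramid p gam i j = 0 ∨ pyramid p gam i j = 1 := by
  unfold pyramid
  split_ifs <;> simp

/-- A zero entry at `(i + 1, j)` forces a zero at `(i, j)`. The cases then give `j - (i + 1)`, `j -
i - 1`, `j - i` and `(j + 1) - i - 1`, the last two when the entry at `(i, j)` is `1`. -/
theorem fn_mem_drond {p : ℕ} (hp : 0 < p) {gam : YoungDiagram} (hcore : IsCore p gam)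
    {i j : ℕ} (hij : i + 1 < j) (hj : j < p) :
    fn p gam i j ∈ drond p gam (j - i - 1 + pyramid p gam i j) := by
  unfold fn
  rw [if_neg (by omega)]
  by_cases h1 : pyramid p gam (i + 1) j = 0
  · have h2 : pyramid p gam i j = 0 := by
      rw [pyramid_eq_zero_iff (by omega)] at h1 ⊢
      have := rho_lt_rho hp gam (show i < i + 1 by omega) (by omega)
      omega
    have h3 := lrPair_mem_drond hp hcore hij hj
    rw [if_pos h1]
    convert h3 using 2
    omega
  rw [if_neg h1]
  have h1' := (pyramid_eq_zero_or_one p gam (i + 1) j).resolve_left h1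
  by_cases h2 : pyramid p gam i j = 0
  · rw [if_pos h2, h2]
    exact lrSq_mem_drond hp hcore (by omega) hj h1' h2
  rw [if_neg h2]
  have h2' := (pyramid_eq_zero_or_one p gam i j).resolve_left h2
  by_cases h3 : pyramid p gam i (j + 1) = 0
  · rw [if_pos h3, h2']
    convert lrOne_mem_drond hp hcore (by omega) h2' h3 using 2
    omega
  · rw [if_neg h3]
    have h3' := (pyramid_eq_zero_or_one p gam i (j + 1)).resolve_left h3
    have hj' := ((pyramid_eq_one_iff (by omega)).1 h3').1
    convert lrPair_mem_drond hp hcore (show i < j + 1 by omega) hj' using 2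
    omega

/-- For `k ≤ m` the lowest beads that define `g_k` lie between those that define `g_m`, so `g_m = 1`
forces `g_k = 1`. -/
theorem middleEntry_eq_one_iff {p : ℕ} (hp : 0 < p) (gam : YoungDiagram) {k : ℕ} (hk : 1 ≤ k)
    (hk' : k ≤ (p - 1) / 2) : middleEntry p gam k = 1 ↔ k ≤ delta p gam := by
  constructor
  · intro h
    exact Finset.le_sup (f := id) (Finset.mem_filter.2 ⟨Finset.mem_Icc.2 ⟨hk, hk'⟩, h⟩)
  · intro h
    -- As `k > 0`, the bound `k ≤ δ` is witnessed by an actual element `m ≥ k` of the set, not by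
    -- the default value of an empty supremum.
    obtain ⟨m, hm, hkm⟩ := (Finset.le_sup_iff (by exact hk : (⊥ : ℕ) < k)).1 h
    rw [Finset.mem_filter, Finset.mem_Icc] at hm
    obtain ⟨⟨hm1, hm2⟩, hm3⟩ := hm
    dsimp only [id] at hkm
    unfold middleEntry at hm3 ⊢
    rw [pyramid_eq_one_iff (by omega)] at hm3 ⊢
    refine ⟨by omega, ?_⟩
    have h1 := rho_lt_rho_iff hp gam (i := (p - 1) / 2 - k) (j := (p - 1) / 2 - m)
      (by omega) (by omega)
    have h2 := rho_lt_rho_iff hp gam (i := (p - 1) / 2 + m) (j := (p - 1) / 2 + k)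
      (by omega) (by omega)
    omega

end WeightTwo

theorem mainTheorem5 (p : ℕ) (hp : p.Prime) (hodd : p ≠ 2) (gam : YoungDiagram)
    (hcore : WeightTwo.IsCore p gam) (hself : gam.transpose = gam)
    (k : ℕ) (hk : 1 ≤ k) (hk' : k ≤ (p - 1) / 2) :
    (k ≤ WeightTwo.delta p gam →
      WeightTwo.mu p gam k ∈ WeightTwo.drond p gam (2 * k) ∧
      WeightTwo.nu p gam k ∈ WeightTwo.drond p gam (2 * k - 1)) ∧
    (WeightTwo.delta p gam < k →
      WeightTwo.mu p gam k ∈ WeightTwo.drond p gam (2 * k - 1) ∧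
      WeightTwo.nu p gam k ∈ WeightTwo.drond p gam (2 * k)) := by
  have hmu := WeightTwo.fn_mem_drond hp.pos hcore (i := (p - 1) / 2 - k) (j := (p - 1) / 2 + k)
    (by omega) (by omega)
  have hnu := WeightTwo.lrPair_mem_drond hp.pos hcore (i := (p - 1) / 2 - k)
    (j := (p - 1) / 2 + k) (by omega) (by omega)
  have hmid := WeightTwo.middleEntry_eq_one_iff hp.pos gam hk hk'
  have h01 := WeightTwo.pyramid_eq_zero_or_one p gam ((p - 1) / 2 - k) ((p - 1) / 2 + k)
  unfold WeightTwo.middleEntry at hmid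
  unfold WeightTwo.mu WeightTwo.nu
  constructor
  · intro h
    rw [hmid.2 h] at hmu hnu
    exact ⟨by convert hmu using 2; omega, by convert hnu using 2; omega⟩
  · intro h
    rw [h01.resolve_right fun h1 => absurd (hmid.1 h1) (by omega)] at hmu hnu
    exact ⟨by convert hmu using 2; omega, by convert hnu using 2; omega⟩
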